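/- Let $A$ be an integral domain with fraction field $K$, let $n\ge 0$ be an integer and $x=(x_1,\dots,x_n)$ a tuple of indeterminates. Let $f\in K[[x]]$ be a formal power series such that at least one of the following holds: (i) $f$ is algebraic over $A[x]$, that is, $P(f)=0$ for some nonzero polynomial $P\in A[x][y]$ (equivalently, $f$ is algebraic over $K[x]$); (ii) $f$ is algebraic and separable over $A[[x]]$, that is, $f$ is algebraic over the fraction field of $A[[x]]$ (inside the fraction field of $K[[x]]$) and its minimal polynomial over that field is separable. In characteristic $0$ this says exactly that $f$ is algebraic over $A[[x]]$. Then there is a nonzero $a\in A$ such that $$a\,f(ax_1,\dots,ax_n)\in A[[x_1,\dots,x_n]].$$ Equivalently, if $f=\sum_{\alpha\in\mathbb{N}^n}f_\alpha x^\alpha$, then $a^{|\alpha|+1}f_\alpha\in A$ for every $\alpha\in\mathbb{N}^n$. -/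

import Mathlib

/-- Let `R → S` be an injective homomorphism of integral domains and let `s : S`. The element `s`
is *algebraic and separable over `R`* if it is a separable (in particular algebraic) element of
`Frac S` over the field `Frac R`: its minimal polynomial over `Frac R` exists and is separable.
Here `Frac S` is a field extension of `Frac R` through the map induced by `R → S`. -/
def IsAlgebraicSeparable (R : Type*) {S : Type*} [CommRing R] [IsDomain R] [CommRing S]
    [IsDomain S] [Algebra R S] [FaithfulSMul R S] (s : S) : Prop :=
  letI : Algebra (FractionRing R) (FractionRing S) := FractionRing.liftAlgebra R (FractionRing S)
  IsSeparable (FractionRing R) (algebraMap S (FractionRing S) s)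

/-- The ring of power series over an integral domain is an integral domain. -/
instance MvPowerSeries.isDomain_of_coeff (σ A : Type*) [CommRing A] [IsDomain A] :
    IsDomain (MvPowerSeries σ A) :=
  NoZeroDivisors.to_isDomain _

/-- Power series over a ring embed into power series over a larger ring. -/
instance MvPowerSeries.faithfulSMul_of_coeff (σ A K : Type*) [CommRing A] [CommRing K]
    [Algebra A K] [FaithfulSMul A K] :
    FaithfulSMul (MvPowerSeries σ A) (MvPowerSeries σ K) := by
  rw [faithfulSMul_iff_algebraMap_injective]
  intro f g h
  ext m
  apply FaithfulSMul.algebraMap_injective A K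
  rw [← MvPowerSeries.coeff_map, ← MvPowerSeries.coeff_map]
  exact congrArg (MvPowerSeries.coeff m) h

/-! Let `f` be a simple root of `P`, whose coefficients are series with a bounded denominator; such
series form a ring containing both `K[x]` and `A[[x]]`. Choose positive weights for which `P'(f)`
has a unique monomial `x^ε` of least weight `e`, and let `u` be the part of `f` of weight at most `e
+ 1`, a polynomial. Then `g = f - u` is a root of a multiple of `P(u + y)` with coefficients in
`A[[x]]`, whose linear coefficient has initial term `c x^ε`. The coefficient of this equation at `ε
+ α` expresses `c g_α` through coefficients of `g` of lower weight, so each unit of weight costs at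
most one factor `c` (`mem_weightFiltration_of_eval_eq_zero`). This linear growth is absorbed by `a ^
(|α| + 1)` (`exists_pow_mul_coeff_mem_range`).

In case (ii) separability provides the simple root. In case (i) the obstruction is a relation
`P(f^p) = 0` in characteristic `p`; a Cartier operator, being `p⁻¹`-linear, turns it into a relation
for `f` of smaller degree (`exists_simple_root_polynomial`). -/

section

open Finset

/-! ### Generic positive weights -/

/-- A nonempty set of exponents has a unique element of least weight for a suitable positive
weight. -/
theorem exists_weight_unique_min {n : ℕ} {S : Set (Fin n →₀ ℕ)} (hS : S.Nonempty) :
    ∃ w : Fin n → ℕ, (∀ i, w i ≠ 0) ∧ ∃ ε ∈ S, ∀ β ∈ S, β ≠ ε →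
      Finsupp.weight w ε < Finsupp.weight w β := by
  obtain ⟨γ, hγ⟩ := hS
  set B := γ.degree + 1 with hB
  -- The degree dominates; among exponents of degree below `B`, ties are broken by the number `v α <
  -- B ^ n` with base-`B` digits `α i`, which determines `α`.
  let w : Fin n → ℕ := fun i => B ^ n + B ^ (i : ℕ)
  have hBn : 0 < B ^ n := by positivity
  have le_deg (α : Fin n →₀ ℕ) (i : Fin n) : α i ≤ α.degree := Finsupp.le_degree i α
  let v : (Fin n →₀ ℕ) → ℕ := fun α => ∑ i, α i * B ^ (i : ℕ)
  have hw (α : Fin n →₀ ℕ) : Finsupp.weight w α = B ^ n * α.degree + v α := by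
    rw [Finsupp.weight_apply, Finsupp.sum_fintype _ _ (by simp), Finsupp.degree_eq_sum, mul_sum,
      ← sum_add_distrib]
    exact sum_congr rfl fun i _ => by simp only [w, smul_eq_mul]; ring
  have hv (α : Fin n →₀ ℕ) (hα : α.degree < B) :
      ∃ a : Fin n → Fin B, (∀ i, (a i : ℕ) = α i) ∧ (finFunctionFinEquiv a : ℕ) = v α :=
    ⟨fun i => ⟨α i, (le_deg α i).trans_lt hα⟩, fun _ => rfl, by rw [finFunctionFinEquiv_apply]⟩
  have hdeg {α : Fin n →₀ ℕ} (hα : Finsupp.weight w α ≤ Finsupp.weight w γ) : α.degree < B := by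
    obtain ⟨a, -, ha⟩ := hv γ (Nat.lt_succ_self _)
    have hlt := (finFunctionFinEquiv a).2
    rw [hw, hw] at hα
    by_contra! hge
    have := Nat.mul_le_mul_left (B ^ n) hge
    rw [hB, mul_add, mul_one, ← hB] at this
    lia
  obtain ⟨ε, hεS, hε⟩ := (⟨_, Function.argminOn_mem (Finsupp.weight w) S ⟨γ, hγ⟩,
    fun β hβ => Function.argminOn_le (Finsupp.weight w) S hβ⟩ :
    ∃ ε ∈ S, ∀ β ∈ S, Finsupp.weight w ε ≤ Finsupp.weight w β)
  refine ⟨w, fun i => by positivity, ε, hεS, fun β hβ hne => lt_of_le_of_ne (hε β hβ) fun heq => ?_⟩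
  have hεγ := hε γ hγ
  obtain ⟨a, ha, hav⟩ := hv ε (hdeg hεγ)
  obtain ⟨b, hb, hbv⟩ := hv β (hdeg (heq ▸ hεγ))
  rw [hw, hw] at heq
  have ha' := (finFunctionFinEquiv a).2
  have hb' := (finFunctionFinEquiv b).2
  rw [hav] at ha'
  rw [hbv] at hb'
  have hvv : v ε = v β := by
    have := congrArg (· % B ^ n) heq
    simpa [Nat.mul_add_mod, Nat.mod_eq_of_lt ha', Nat.mod_eq_of_lt hb'] using this
  have hab : a = b := finFunctionFinEquiv.injective (Fin.ext (by rw [hav, hbv, hvv]))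
  exact hne (Finsupp.ext fun i => by rw [← ha, ← hb, hab])

/-! ### Growth of denominators along a weight -/

namespace MvPowerSeries

variable {σ K : Type*} [Field K]

/-- The power series of weighted order at least `j` whose coefficient at `α`, multiplied by
`c ^ (weight w α - j)`, lies in the subring `B`. -/
def weightFiltration (w : σ → ℕ) (B : Subring K) (c : K) (j : ℕ) :
    AddSubgroup (MvPowerSeries σ K) where
  carrier := {h | ∀ α, (Finsupp.weight w α < j → coeff α h = 0) ∧
    c ^ (Finsupp.weight w α - j) * coeff α h ∈ B}
  zero_mem' α := by simp
  add_mem' {g h} hg hh α := by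
    refine ⟨fun hα => by simp [(hg α).1 hα, (hh α).1 hα], ?_⟩
    rw [map_add, mul_add]
    exact B.add_mem (hg α).2 (hh α).2
  neg_mem' {g} hg α := by
    refine ⟨fun hα => by simp [(hg α).1 hα], ?_⟩
    rw [map_neg, mul_neg]
    exact B.neg_mem (hg α).2

section weightFiltration

variable {w : σ → ℕ} {B : Subring K} {c : K} {i j : ℕ} {g h : MvPowerSeries σ K}

theorem mem_weightFiltration : h ∈ weightFiltration w B c j ↔
    ∀ α, (Finsupp.weight w α < j → coeff α h = 0) ∧
      c ^ (Finsupp.weight w α - j) * coeff α h ∈ B := Iff.rfl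

/-- Over `⊤` the integrality condition is void, so the filtration also serves for plain order
estimates. -/
theorem mem_weightFiltration_top : h ∈ weightFiltration w (⊤ : Subring K) c j ↔
    ∀ α, Finsupp.weight w α < j → coeff α h = 0 := by
  simp [mem_weightFiltration]

/-- The excesses of the weights over `i` and `j` add up. As subtraction is truncated, terms below
either order are first discarded as zero. -/
theorem mul_mem_weightFiltration (hg : g ∈ weightFiltration w B c i)
    (hh : h ∈ weightFiltration w B c j) : g * h ∈ weightFiltration w B c (i + j) := by
  classical
  refine fun α => ⟨fun hα => ?_, ?_⟩
  · rw [coeff_mul]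
    refine sum_eq_zero fun x hx => ?_
    rw [HasAntidiagonal.mem_antidiagonal] at hx
    rw [← hx, map_add] at hα
    by_cases h1 : Finsupp.weight w x.1 < i
    · rw [(hg _).1 h1, zero_mul]
    · rw [(hh x.2).1 (by lia), mul_zero]
  · rw [coeff_mul, mul_sum]
    refine B.sum_mem fun x hx => ?_
    rw [HasAntidiagonal.mem_antidiagonal] at hx
    rw [← hx, map_add]
    by_cases h1 : Finsupp.weight w x.1 < i
    · rw [(hg _).1 h1]; simp
    by_cases h2 : Finsupp.weight w x.2 < j
    · rw [(hh _).1 h2]; simp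
    rw [show Finsupp.weight w x.1 + Finsupp.weight w x.2 - (i + j) =
      (Finsupp.weight w x.1 - i) + (Finsupp.weight w x.2 - j) by lia, pow_add, mul_mul_mul_comm]
    exact B.mul_mem (hg _).2 (hh _).2

theorem mem_weightFiltration_of_coeff_mem (hc : c ∈ B) (hh : ∀ α, coeff α h ∈ B)
    (hj : ∀ α, Finsupp.weight w α < j → coeff α h = 0) : h ∈ weightFiltration w B c j :=
  fun α => ⟨hj α, B.mul_mem (B.pow_mem hc _) (hh α)⟩

theorem weightFiltration_anti (hc : c ∈ B) (hij : i ≤ j) :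
    weightFiltration w B c j ≤ weightFiltration w B c i := by
  refine fun g hg α => ⟨fun hα => (hg α).1 (hα.trans_le hij), ?_⟩
  by_cases h : Finsupp.weight w α < j
  · rw [(hg α).1 h]; simp
  · rw [show Finsupp.weight w α - i = (j - i) + (Finsupp.weight w α - j) by lia, pow_add, mul_assoc]
    exact B.mul_mem (B.pow_mem hc _) (hg α).2

theorem eval_mem_weightFiltration_zero (hc : c ∈ B) {Q : Polynomial (MvPowerSeries σ K)}
    (hQ : ∀ i α, coeff α (Q.coeff i) ∈ B) (hh : h ∈ weightFiltration w B c 0) :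
    Q.eval h ∈ weightFiltration w B c 0 := by
  classical
  have hpow (i : ℕ) : h ^ i ∈ weightFiltration w B c 0 := by
    induction i with
    | zero =>
      refine mem_weightFiltration_of_coeff_mem hc (fun α => ?_) (by simp)
      rw [pow_zero, coeff_one]
      split_ifs
      exacts [B.one_mem, B.zero_mem]
    | succ i ih => exact pow_succ h i ▸ mul_mem_weightFiltration ih hh
  rw [Polynomial.eval_eq_sum_range]
  exact AddSubgroup.sum_mem _ fun i _ => mul_mem_weightFiltration (i := 0)
    (mem_weightFiltration_of_coeff_mem hc (hQ i) (by simp)) (hpow i)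

/-- A root of large weighted order of a polynomial over `B[[x]]` whose linear coefficient has a
unique monomial of least weight, with coefficient `c`: its denominators are powers of `c` that grow
linearly with the weight. -/
theorem mem_weightFiltration_of_eval_eq_zero {Q : Polynomial (MvPowerSeries σ K)}
    (hQ : ∀ i α, coeff α (Q.coeff i) ∈ B) {ε : σ →₀ ℕ}
    (hε : ∀ β, coeff β (Q.coeff 1) ≠ 0 → β ≠ ε → Finsupp.weight w ε < Finsupp.weight w β)
    (hg : ∀ α, Finsupp.weight w α < Finsupp.weight w ε + 2 → coeff α g = 0)
    (hroot : Q.eval g = 0) :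
    g ∈ weightFiltration w B (coeff ε (Q.coeff 1)) (Finsupp.weight w ε + 1) := by
  classical
  set c := coeff ε (Q.coeff 1) with hc_def
  set e := Finsupp.weight w ε with he
  have hc : c ∈ B := hQ 1 ε
  suffices H : ∀ m α, Finsupp.weight w α = m → c ^ (m - (e + 1)) * coeff α g ∈ B from
    fun α => ⟨fun hα => hg α (by lia), H _ α rfl⟩
  intro m
  induction m using Nat.strong_induction_on with
  | _ m ih =>
  intro α hα
  by_cases hm : m < e + 2
  · rw [hg α (by lia)]; simp
  -- split `g` at weight `m`
  let h : MvPowerSeries σ K := fun β => if Finsupp.weight w β < m then coeff β g else 0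
  have coeff_h (β) : coeff β h = if Finsupp.weight w β < m then coeff β g else 0 := rfl
  have hh : h ∈ weightFiltration w B c (e + 1) := by
    refine fun β => ⟨fun hβ => ?_, ?_⟩
    · rw [coeff_h, hg β (by lia), ite_self]
    · rw [coeff_h]
      split_ifs with hβ
      · exact ih _ hβ β rfl
      · simp
  have hh' : h ∈ weightFiltration w (⊤ : Subring K) c (e + 2) :=
    mem_weightFiltration_top.2 fun β hβ => by rw [coeff_h, hg β hβ, ite_self]
  set r := g - h with hr_def
  have coeff_r (β) : coeff β r = if Finsupp.weight w β < m then 0 else coeff β g := by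
    rw [hr_def, map_sub, coeff_h]; split_ifs <;> simp
  have hr : r ∈ weightFiltration w (⊤ : Subring K) c m :=
    mem_weightFiltration_top.2 fun β hβ => by rw [coeff_r, if_pos hβ]
  have mem_zero (k : MvPowerSeries σ K) : k ∈ weightFiltration w (⊤ : Subring K) c 0 :=
    mem_weightFiltration_top.2 (by simp)
  have hwt : Finsupp.weight w (ε + α) = e + m := by rw [map_add, hα]
  obtain ⟨k, hk⟩ := Q.binomExpansion h r
  obtain ⟨z, hz⟩ := Q.derivative.evalSubFactor h 0
  have hz' : Q.derivative.eval h = Q.coeff 1 + z * h := by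
    rw [sub_zero, sub_eq_iff_eq_add, ← Polynomial.coeff_zero_eq_eval_zero,
      Polynomial.coeff_derivative] at hz
    rw [hz]; simp [add_comm]
  rw [hr_def, add_sub_cancel, hroot, ← hr_def, hz'] at hk
  -- Since `m ≥ e + 2`, the order `2 * m` of `r ^ 2` exceeds `e + m`.
  have h1 : coeff (ε + α) (k * r ^ 2) = 0 := by
    rw [pow_two]
    exact mem_weightFiltration_top.1
      (mul_mem_weightFiltration (mem_zero k) (mul_mem_weightFiltration hr hr)) _ (by lia)
  have h2 : coeff (ε + α) (z * h * r) = 0 :=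
    mem_weightFiltration_top.1
      (mul_mem_weightFiltration (mul_mem_weightFiltration (mem_zero z) hh') hr) _ (by lia)
  have h3 : coeff (ε + α) (Q.coeff 1 * r) = c * coeff α g := by
    rw [coeff_mul, sum_eq_single_of_mem (ε, α) (by simp)]
    · rw [coeff_r, if_neg (by lia)]
    · rintro ⟨β, γ⟩ hx hne
      rw [HasAntidiagonal.mem_antidiagonal] at hx
      dsimp only at hx ⊢
      have hwt' : Finsupp.weight w β + Finsupp.weight w γ = e + m := by rw [← map_add, hx, hwt]
      by_cases h0 : coeff β (Q.coeff 1) = 0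
      · rw [h0, zero_mul]
      · have hβ : β ≠ ε := by
          rintro rfl
          exact hne (by rw [add_left_cancel hx])
        have := hε β h0 hβ
        rw [coeff_r, if_pos (by lia), mul_zero]
  -- One power of `c` is saved for `h5`: `h` has no term of weight `m`, so `c x^ε` contributes
  -- nothing, and each other nonconstant term contains two factors of level `e + 1`.
  have h4 : c ^ (m - (e + 2)) * coeff (ε + α) (Q.eval h) ∈ B := by
    have hQh : Q.eval h = Q.coeff 0 + monomial ε c * h + (Q.coeff 1 - monomial ε c) * h +
        Q.divX.divX.eval h * (h * h) := by
      conv_lhs => rw [← Q.divX_mul_X_add, ← Q.divX.divX_mul_X_add]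
      simp only [Polynomial.eval_add, Polynomial.eval_mul, Polynomial.eval_X, Polynomial.eval_C,
        Polynomial.coeff_divX]
      ring
    have e1 : coeff (ε + α) (monomial ε c * h) = 0 := by
      rw [coeff_add_monomial_mul, coeff_h, if_neg (by lia), mul_zero]
    have e2 : c ^ (m - (e + 2)) * coeff (ε + α) ((Q.coeff 1 - monomial ε c) * h) ∈ B := by
      have hlin : Q.coeff 1 - monomial ε c ∈ weightFiltration w B c (e + 1) := by
        have hcoeff (β) : coeff β (Q.coeff 1 - monomial ε c) =
            if β = ε then 0 else coeff β (Q.coeff 1) := by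
          rw [map_sub, coeff_monomial]
          split_ifs with h
          · rw [h, ← hc_def, sub_self]
          · rw [sub_zero]
        refine mem_weightFiltration_of_coeff_mem hc (fun β => ?_) (fun β hβ => ?_)
        · rw [hcoeff]
          split_ifs
          exacts [B.zero_mem, hQ 1 β]
        · rw [hcoeff]
          split_ifs with hne
          · rfl
          · by_contra h0
            have := hε β h0 hne
            lia
      have := (mul_mem_weightFiltration hlin hh (ε + α)).2
      rwa [hwt, show e + m - (e + 1 + (e + 1)) = m - (e + 2) by lia] at this
    have e3 : c ^ (m - (e + 2)) * coeff (ε + α) (Q.divX.divX.eval h * (h * h)) ∈ B := by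
      have h0 : Q.divX.divX.eval h ∈ weightFiltration w B c 0 :=
        eval_mem_weightFiltration_zero hc (fun i β => by simpa using hQ _ β)
          (weightFiltration_anti hc (Nat.zero_le _) hh)
      have := (mul_mem_weightFiltration h0 (mul_mem_weightFiltration hh hh) (ε + α)).2
      rwa [hwt, show e + m - (0 + (e + 1 + (e + 1))) = m - (e + 2) by lia] at this
    rw [hQh, map_add, map_add, map_add, e1, add_zero, mul_add, mul_add]
    exact B.add_mem (B.add_mem (B.mul_mem (B.pow_mem hc _) (hQ 0 _)) e2) e3
  have h5 : c * coeff α g = -coeff (ε + α) (Q.eval h) := by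
    have := congrArg (coeff (ε + α)) hk
    rw [add_mul, map_add, map_add, map_add, h1, h2, h3, map_zero] at this
    linear_combination -this
  rw [show m - (e + 1) = m - (e + 2) + 1 by lia, pow_succ, mul_assoc, h5, mul_neg]
  exact B.neg_mem h4

end weightFiltration

end MvPowerSeries

/-! ### Bounded denominators and Eisenstein's theorem for simple roots -/

namespace MvPowerSeries

/-- The power series over `K` that a nonzero element of `A` multiplies into the series with
coefficients in `A`. -/
def boundedDenominators (σ A K : Type*) [CommRing A] [IsDomain A] [CommRing K] [Algebra A K] :
    Subring (MvPowerSeries σ K) where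
  carrier := {h | ∃ d : A, d ≠ 0 ∧ ∀ α, algebraMap A K d * coeff α h ∈ (algebraMap A K).range}
  zero_mem' := ⟨1, one_ne_zero, fun α => by simp⟩
  one_mem' := by
    classical
    refine ⟨1, one_ne_zero, fun α => ?_⟩
    rw [map_one, one_mul, coeff_one]
    split_ifs
    exacts [Subring.one_mem _, Subring.zero_mem _]
  add_mem' := by
    rintro g h ⟨d, hd, hg⟩ ⟨e, he, hh⟩
    refine ⟨d * e, mul_ne_zero hd he, fun α => ?_⟩
    rw [map_mul, map_add, show ∀ x y z t : K, x * y * (z + t) = y * (x * z) + x * (y * t) by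
      intros; ring]
    exact Subring.add_mem _ (Subring.mul_mem _ ⟨e, rfl⟩ (hg α)) (Subring.mul_mem _ ⟨d, rfl⟩ (hh α))
  neg_mem' := by
    rintro g ⟨d, hd, hg⟩
    exact ⟨d, hd, fun α => by rw [map_neg, mul_neg]; exact Subring.neg_mem _ (hg α)⟩
  mul_mem' := by
    classical
    rintro g h ⟨d, hd, hg⟩ ⟨e, he, hh⟩
    refine ⟨d * e, mul_ne_zero hd he, fun α => ?_⟩
    rw [coeff_mul, mul_sum, map_mul]
    refine Subring.sum_mem _ fun x _ => ?_
    rw [mul_mul_mul_comm]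
    exact Subring.mul_mem _ (hg _) (hh _)

variable {σ A K : Type*} [CommRing A] [IsDomain A] [Field K] [Algebra A K]

theorem map_mem_boundedDenominators (h : MvPowerSeries σ A) :
    map (algebraMap A K) h ∈ boundedDenominators σ A K :=
  ⟨1, one_ne_zero, fun α => ⟨coeff α h, by simp⟩⟩

theorem mem_boundedDenominators_of_finite_support [IsFractionRing A K] {h : MvPowerSeries σ K}
    {s : Set (σ →₀ ℕ)} (hs : s.Finite) (hh : ∀ α ∉ s, coeff α h = 0) :
    h ∈ boundedDenominators σ A K := by
  obtain ⟨b, hb⟩ := IsLocalization.exist_integer_multiples (nonZeroDivisors A) hs.toFinset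
    (fun α => coeff α h)
  refine ⟨b, nonZeroDivisors.coe_ne_zero b, fun α => ?_⟩
  by_cases hα : α ∈ s
  · obtain ⟨a, ha⟩ := hb α (by simpa using hα)
    exact ⟨a, by rw [ha, Algebra.smul_def]⟩
  · rw [hh α hα, mul_zero]
    exact Subring.zero_mem _

/-- The coefficients of a polynomial over the series with bounded denominators have a common
denominator. -/
theorem exists_common_denominator {P : Polynomial (MvPowerSeries σ K)}
    (hP : ∀ i, P.coeff i ∈ boundedDenominators σ A K) :
    ∃ d : A, d ≠ 0 ∧ ∀ i α, algebraMap A K d * coeff α (P.coeff i) ∈ (algebraMap A K).range := by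
  choose d hd hdP using hP
  refine ⟨∏ i ∈ P.support, d i, prod_ne_zero_iff.2 fun i _ => hd i, fun i α => ?_⟩
  by_cases hi : i ∈ P.support
  · rw [← mul_prod_erase _ _ hi, mul_comm (d i), map_mul, mul_assoc]
    exact Subring.mul_mem _ ⟨_, rfl⟩ (hdP i α)
  · rw [Polynomial.notMem_support_iff.1 hi, map_zero, mul_zero]
    exact Subring.zero_mem _

theorem taylor_coeff_mem {R : Type*} [CommRing R] (T : Subring R) {P : Polynomial R} {u : R}
    (hP : ∀ i, P.coeff i ∈ T) (hu : u ∈ T) (i : ℕ) : (Polynomial.taylor u P).coeff i ∈ T := by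
  obtain ⟨P, rfl⟩ := (Polynomial.lifts_iff_set_range P).1
    ((Polynomial.lifts_iff_coeff_lifts (f := T.subtype) P).2 fun i => ⟨⟨_, hP i⟩, rfl⟩)
  lift u to T using hu
  have := Polynomial.map_taylor P u T.subtype
  rw [Subring.subtype_apply] at this
  rw [← this, Polynomial.coeff_map]
  exact ((Polynomial.taylor u P).coeff i).2

/-- **Eisenstein's theorem** for a simple root of a polynomial over the series with bounded
denominators. -/
theorem exists_pow_mul_coeff_mem_range [IsFractionRing A K] {n : ℕ}
    {P : Polynomial (MvPowerSeries (Fin n) K)} {f : MvPowerSeries (Fin n) K}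
    (hP : ∀ i, P.coeff i ∈ boundedDenominators (Fin n) A K) (hroot : P.eval f = 0)
    (hsimple : P.derivative.eval f ≠ 0) :
    ∃ a : A, a ≠ 0 ∧
      ∀ α, algebraMap A K a ^ (α.degree + 1) * coeff α f ∈ (algebraMap A K).range := by
  classical
  set B : Subring K := (algebraMap A K).range
  have hinj := FaithfulSMul.algebraMap_injective A K
  have hne : {α | coeff α (P.derivative.eval f) ≠ 0}.Nonempty := by
    by_contra! h
    exact hsimple (MvPowerSeries.ext fun α => by_contra fun hα =>
      (Set.eq_empty_iff_forall_notMem.1 h α) hα)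
  obtain ⟨w, hw, ε, hεS, hε⟩ := exists_weight_unique_min hne
  -- Cutting after weight `e + 1`, where `e` is the weight of `ε`, gives `f - u` order at least `e +
  -- 2`, so `P'(u)` and `P'(f)` have the same initial term.
  let u : MvPowerSeries (Fin n) K := fun α =>
    if Finsupp.weight w α ≤ Finsupp.weight w ε + 1 then coeff α f else 0
  have coeff_u (α) : coeff α u =
    if Finsupp.weight w α ≤ Finsupp.weight w ε + 1 then coeff α f else 0 := rfl
  have hu : u ∈ boundedDenominators (Fin n) A K :=
    mem_boundedDenominators_of_finite_support
      (Finsupp.finite_of_nat_weight_le w hw (Finsupp.weight w ε + 1))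
      fun α hα => if_neg hα
  have hg (α) (hα : Finsupp.weight w α < Finsupp.weight w ε + 2) : coeff α (f - u) = 0 := by
    rw [map_sub, coeff_u, if_pos (by lia), sub_self]
  obtain ⟨d, hd, hdP⟩ := exists_common_denominator (taylor_coeff_mem _ hP hu)
  have hdK : algebraMap A K d ≠ 0 := by simpa using hinj.ne hd
  set Q := Polynomial.C (C (algebraMap A K d)) * Polynomial.taylor u P with hQdef
  have hQ (i α) : coeff α (Q.coeff i) ∈ B := by
    rw [hQdef, Polynomial.coeff_C_mul, coeff_C_mul]
    exact hdP i α
  have hQroot : Q.eval (f - u) = 0 := by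
    rw [hQdef, Polynomial.eval_mul, Polynomial.taylor_eval, sub_add_cancel, hroot, mul_zero]
  have hQ1 (α) (hα : Finsupp.weight w α < Finsupp.weight w ε + 2) :
      coeff α (Q.coeff 1) = algebraMap A K d * coeff α (P.derivative.eval f) := by
    rw [hQdef, Polynomial.coeff_C_mul, coeff_C_mul, Polynomial.taylor_coeff_one]
    congr 1
    obtain ⟨z, hz⟩ := P.derivative.evalSubFactor f u
    have h0 : coeff α (z * (f - u)) = 0 := by
      have := mul_mem_weightFiltration (w := w) (B := ⊤) (c := (0 : K)) (i := 0) (g := z)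
        (mem_weightFiltration_top.2 (by simp)) (mem_weightFiltration_top.2 hg)
      exact mem_weightFiltration_top.1 this α (by lia)
    rw [← hz, map_sub, sub_eq_zero] at h0
    exact h0.symm
  have hεQ (β) (hβ : coeff β (Q.coeff 1) ≠ 0) (hne : β ≠ ε) :
      Finsupp.weight w ε < Finsupp.weight w β := by
    by_contra! hle
    rw [hQ1 β (by lia)] at hβ
    exact (hε β (right_ne_zero_of_mul hβ) hne).not_ge hle
  have hmem := mem_weightFiltration_of_eval_eq_zero hQ hεQ hg hQroot
  obtain ⟨c, hc⟩ := hQ 1 ε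
  have hc0 : c ≠ 0 := by
    rintro rfl
    rw [map_zero, hQ1 ε (by lia)] at hc
    exact mul_ne_zero hdK hεS hc.symm
  obtain ⟨e, he, heu⟩ := hu
  set W := ∑ i, w i with hW
  have hdeg (α : Fin n →₀ ℕ) : Finsupp.weight w α ≤ α.degree * W := by
    rw [Finsupp.weight_apply, Finsupp.sum_fintype _ _ (by simp), Finsupp.degree_eq_sum, sum_mul]
    exact sum_le_sum fun i _ => Nat.mul_le_mul_left _ (single_le_sum (by simp) (mem_univ i))
  -- `e` clears `u`; the power of `c` needed at `α` is at most the weight of `α`, hence at most `W *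
  -- (α.degree + 1)`.
  refine ⟨e * c ^ W, mul_ne_zero he (pow_ne_zero _ hc0), fun α => ?_⟩
  rw [show f = u + (f - u) by ring, map_add, mul_add]
  refine B.add_mem ?_ ?_
  · rw [map_mul, mul_pow, pow_succ (algebraMap A K e),
      show ∀ x y z t : K, x * y * z * t = x * z * (y * t) by intros; ring]
    exact B.mul_mem (B.mul_mem ⟨e ^ α.degree, by simp⟩ ⟨(c ^ W) ^ (α.degree + 1), by simp⟩) (heu α)
  · have h1 := (hmem α).2
    rw [← hc] at h1
    obtain ⟨k, hk⟩ := Nat.exists_eq_add_of_le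
      (((Nat.sub_le _ (Finsupp.weight w ε + 1)).trans (hdeg α)).trans
        (Nat.mul_le_mul_right W (Nat.le_succ α.degree)))
    rw [map_mul, mul_pow, map_pow, ← pow_mul, mul_comm W, ← Nat.succ_eq_add_one, hk, pow_add,
      show ∀ x y z t : K, x * (y * z) * t = x * z * (y * t) by intros; ring]
    exact B.mul_mem (B.mul_mem ⟨e ^ _, by simp; rfl⟩ ⟨c ^ k, by simp⟩) h1

end MvPowerSeries

/-! ### Cartier operators and inseparable relations -/

/-- In characteristic `p` there is a `p⁻¹`-linear functional that does not vanish at `a`. -/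
theorem exists_frobenius_inv_linear_functional {K : Type*} [Field K] (p : ℕ) [ExpChar K p] {a : K}
    (ha : a ≠ 0) : ∃ φ : K →+ K, (∀ x y, φ (x ^ p * y) = x * φ y) ∧ φ a ≠ 0 := by
  -- A linear form over the subfield of `p`-th powers becomes `p⁻¹`-linear after composition with
  -- the inverse of Frobenius.
  let e : K ≃+* (frobenius K p).fieldRange :=
    RingEquiv.ofBijective (frobenius K p).rangeRestrictField
    ⟨(frobenius K p).rangeRestrictField.injective, (frobenius K p).rangeRestrictField_bijective.2⟩
  obtain ⟨ψ, hψ⟩ := Module.Projective.exists_dual_ne_zero (frobenius K p).fieldRange ha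
  refine ⟨e.symm.toAddMonoidHom.comp ψ.toAddMonoidHom, fun x y => ?_, by simpa using hψ⟩
  have h1 : x ^ p * y = e x • y := rfl
  change e.symm (ψ (x ^ p * y)) = x * e.symm (ψ y)
  rw [h1, map_smul, smul_eq_mul, map_mul, e.symm_apply_apply]

namespace MvPowerSeries

variable {σ K : Type*} [Field K] {p : ℕ}

/-- The Cartier operator sending `f` to the series with coefficient `φ (f_{p α + β})` at `α`. -/
noncomputable def cartier (p : ℕ) (β : σ →₀ ℕ) (φ : K →+ K) :
    MvPowerSeries σ K →+ MvPowerSeries σ K where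
  toFun f := fun α => φ (coeff (p • α + β) f)
  map_zero' := by ext α; change φ _ = 0; simp
  map_add' f g := by
    ext α
    change φ _ = φ _ + φ _
    rw [map_add, map_add]

theorem coeff_cartier (β : σ →₀ ℕ) (φ : K →+ K) (f : MvPowerSeries σ K) (α : σ →₀ ℕ) :
    coeff α (cartier p β φ f) = φ (coeff (p • α + β) f) := rfl

/-- The series `g ^ p` has coefficient `g_m ^ p` at `p m` and no others. Since `β i < p`, `p m ≤ p α
+ β` forces `m ≤ α`, so the surviving terms match the product on the right. -/
theorem cartier_pow_mul [hp : Fact p.Prime] [CharP K p] {β : σ →₀ ℕ} {φ : K →+ K}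
    (hβ : ∀ i, β i < p) (hφ : ∀ x y, φ (x ^ p * y) = x * φ y) (f g : MvPowerSeries σ K) :
    cartier p β φ (g ^ p * f) = g * cartier p β φ f := by
  classical
  have hp0 : p ≠ 0 := hp.out.ne_zero
  ext α
  rw [coeff_cartier, coeff_mul, coeff_mul, map_sum]
  symm
  refine sum_of_injOn (fun y => (p • y.1, p • y.2 + β)) ?_ ?_ ?_ ?_
  · rintro ⟨a, b⟩ - ⟨c, d⟩ - h
    simp only [Prod.mk.injEq, add_left_inj, nsmul_right_inj hp0] at h
    exact Prod.ext h.1 h.2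
  · rintro ⟨a, b⟩ h
    simp only [mem_coe, HasAntidiagonal.mem_antidiagonal] at h ⊢
    rw [← h, smul_add, add_assoc]
  · rintro ⟨a, b⟩ h hne
    rw [HasAntidiagonal.mem_antidiagonal] at h
    dsimp only at h ⊢
    rw [← map_frobenius_expand p hp0, coeff_map]
    by_cases! hdvd : ∀ i, p ∣ a i
    · refine absurd ?_ hne
      obtain ⟨m, rfl⟩ : ∃ m, p • m = a := ⟨a.mapRange (fun x => x / p) (by simp),
        by ext i; simp [Nat.mul_div_cancel' (hdvd i)]⟩
      have hm : m ≤ α := fun i => by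
        have h1 := DFunLike.congr_fun h i
        simp only [Finsupp.add_apply, Finsupp.smul_apply, smul_eq_mul] at h1
        have h2 := hβ i
        by_contra! hlt
        have := Nat.mul_le_mul_left p hlt
        rw [Nat.succ_eq_add_one, mul_add, mul_one] at this
        lia
      obtain ⟨k, rfl⟩ := exists_add_of_le hm
      rw [smul_add, add_assoc, add_left_cancel_iff] at h
      exact ⟨(m, k), by simp, by rw [h]⟩
    · obtain ⟨i, hi⟩ := hdvd
      rw [coeff_expand_of_not_dvd p hp0 _ hi, map_zero, zero_mul, map_zero]
  · rintro ⟨a, b⟩ -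
    dsimp only
    rw [← map_frobenius_expand p hp0, coeff_map, coeff_expand_smul, frobenius_def, hφ,
      coeff_cartier]

theorem exists_coe_eq_of_finite {R : Type*} [CommSemiring R] {h : MvPowerSeries σ R}
    (hh : {α | coeff α h ≠ 0}.Finite) : ∃ P : MvPolynomial σ R, (P : MvPowerSeries σ R) = h := by
  classical
  refine ⟨∑ α ∈ hh.toFinset, MvPolynomial.monomial α (coeff α h), ?_⟩
  ext α
  simp only [MvPolynomial.coeff_coe, MvPolynomial.coeff_sum, MvPolynomial.coeff_monomial,
    sum_ite_eq', Set.Finite.mem_toFinset, Set.mem_ofPred_eq]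
  split_ifs with h0
  · rfl
  · exact (not_not.1 h0).symm

theorem exists_coe_eq_cartier (hp : p ≠ 0) (β : σ →₀ ℕ) (φ : K →+ K) (P : MvPolynomial σ K) :
    ∃ R : MvPolynomial σ K, (R : MvPowerSeries σ K) = cartier p β φ P := by
  refine exists_coe_eq_of_finite ?_
  have hinj : Function.Injective fun α : σ →₀ ℕ => p • α + β := fun a b h => by
    simpa [nsmul_right_inj hp] using h
  refine (P.support.finite_toSet.preimage hinj.injOn).subset fun α hα => ?_
  simp only [Set.mem_preimage, mem_coe, MvPolynomial.mem_support_iff]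
  rintro h0
  rw [Set.mem_ofPred_eq, coeff_cartier, MvPolynomial.coeff_coe, h0, map_zero] at hα
  exact hα rfl

open Polynomial in
/-- A power series over a field that is a root of a polynomial in `y ^ p` with polynomial
coefficients is a root of a polynomial of smaller degree. -/
theorem exists_eval_eq_zero_of_eval_expand [hp : Fact p.Prime] [CharP K p]
    {P : (MvPolynomial σ K)[X]} (hP : P ≠ 0) {f : MvPowerSeries σ K}
    (hf : ((Polynomial.expand _ p P).map MvPolynomial.coeToMvPowerSeries.ringHom).eval f = 0) :
    ∃ R : (MvPolynomial σ K)[X], R ≠ 0 ∧ R.natDegree ≤ P.natDegree ∧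
      (R.map MvPolynomial.coeToMvPowerSeries.ringHom).eval f = 0 := by
  have hp0 : p ≠ 0 := hp.out.ne_zero
  set ι := MvPolynomial.coeToMvPowerSeries.ringHom (σ := σ) (R := K)
  obtain ⟨γ, hγ⟩ := MvPolynomial.ne_zero_iff.1 (leadingCoeff_ne_zero.2 hP)
  obtain ⟨φ, hφ, hφγ⟩ := exists_frobenius_inv_linear_functional p hγ
  -- With `β` the residue of `γ` modulo `p`, the operator sends the leading coefficient to a series
  -- whose coefficient at `δ` is `φ` of its coefficient at `γ`, which is nonzero.
  let β : σ →₀ ℕ := γ.mapRange (fun x => x % p) (by simp)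
  let δ : σ →₀ ℕ := γ.mapRange (fun x => x / p) (by simp)
  have hγ' : p • δ + β = γ := Finsupp.ext fun i => Nat.div_add_mod (γ i) p
  have hβ (i) : β i < p := Nat.mod_lt _ hp.out.pos
  choose r hr using fun i => exists_coe_eq_cartier hp0 β φ (P.coeff i)
  have hcoeff (i) : (∑ j ∈ range (P.natDegree + 1), Polynomial.monomial j (r j)).coeff i =
      if i ∈ range (P.natDegree + 1) then r i else 0 := by
    simp [Polynomial.coeff_monomial]
  refine ⟨∑ j ∈ range (P.natDegree + 1), Polynomial.monomial j (r j), fun h0 => hφγ ?_, ?_, ?_⟩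
  · have h1 : r P.natDegree = 0 := by
      rw [← if_pos (c := P.natDegree ∈ range (P.natDegree + 1)) (t := r _) (e := 0) (by simp),
        ← hcoeff, h0, Polynomial.coeff_zero]
    have h2 := hr P.natDegree
    rw [h1, MvPolynomial.coe_zero] at h2
    have h3 := congrArg (MvPowerSeries.coeff δ) h2
    rw [coeff_cartier, hγ', MvPolynomial.coeff_coe, map_zero] at h3
    exact h3.symm
  · refine natDegree_sum_le_of_forall_le _ _ fun i hi => (natDegree_monomial_le _).trans ?_
    exact Nat.lt_succ_iff.1 (mem_range.1 hi)
  · rw [Polynomial.map_expand, expand_eval, eval_map, eval₂_eq_sum_range] at hf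
    have := congrArg (cartier p β φ) hf
    rw [map_zero, map_sum] at this
    rw [Polynomial.map_sum, eval_finsetSum, ← this]
    refine sum_congr rfl fun i _ => ?_
    rw [Polynomial.map_monomial, eval_monomial, ← pow_mul, mul_comm p, pow_mul,
      mul_comm (ι _) ((f ^ i) ^ p), cartier_pow_mul hβ hφ, mul_comm]
    congr 1
    exact hr i

open Polynomial in
/-- A power series that is algebraic over the polynomials over a field is a simple root of a
polynomial, in every characteristic. -/
theorem exists_simple_root_polynomial {f : MvPowerSeries σ K} (P : (MvPolynomial σ K)[X])
    (hP : P ≠ 0) (hf : (P.map MvPolynomial.coeToMvPowerSeries.ringHom).eval f = 0) :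
    ∃ Q : (MvPolynomial σ K)[X], (Q.map MvPolynomial.coeToMvPowerSeries.ringHom).eval f = 0 ∧
      (Q.map MvPolynomial.coeToMvPowerSeries.ringHom).derivative.eval f ≠ 0 := by
  induction hd : P.natDegree using Nat.strong_induction_on generalizing P with
  | _ d ih =>
  subst hd
  set ι := MvPolynomial.coeToMvPowerSeries.ringHom (σ := σ) (R := K)
  have hd0 : P.natDegree ≠ 0 := fun h0 => by
    obtain ⟨a, rfl⟩ := natDegree_eq_zero.1 h0
    rw [Polynomial.map_C, eval_C] at hf
    exact hP (by rw [MvPolynomial.coe_eq_zero_iff.1 hf, C_0])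
  by_cases h1 : (P.map ι).derivative.eval f = 0
  swap
  · exact ⟨P, hf, h1⟩
  -- A nonzero derivative vanishing at `f` is itself a relation of smaller degree. Otherwise `P` is
  -- a polynomial in `y ^ p`.
  by_cases h2 : P.derivative = 0
  swap
  · exact ih _ (natDegree_derivative_lt hd0) _ h2 (by rwa [← derivative_map]) rfl
  obtain ⟨p, hchar⟩ := CharP.exists K
  obtain hp | rfl := CharP.char_is_prime_or_zero K p
  · have : Fact p.Prime := ⟨hp⟩
    have hPe := expand_contract p h2 hp.ne_zero
    have hc : contract p P ≠ 0 := fun h => hP (by rw [← hPe, h, map_zero])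
    have hdeg : (contract p P).natDegree < P.natDegree := by
      conv_rhs => rw [← hPe, natDegree_expand]
      refine lt_mul_of_one_lt_right (Nat.pos_of_ne_zero fun h => hd0 ?_) hp.one_lt
      rw [← hPe, natDegree_expand, h, zero_mul]
    obtain ⟨R, hR, hRdeg, hRf⟩ := exists_eval_eq_zero_of_eval_expand hc (by rwa [hPe])
    exact ih _ (hRdeg.trans_lt hdeg) R hR hRf rfl
  · have := CharP.charP_to_charZero K
    exact absurd (derivative_eq_zero.1 h2) hd0

end MvPowerSeries

/-! ### Separable elements as simple roots -/

open Polynomial in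
/-- A separable element over a fraction field is a simple root of a polynomial over the ring. -/
theorem IsSeparable.exists_simple_root {R S F L : Type*} [CommRing R] [IsDomain R] [CommRing S]
    [Field F] [Field L] [Algebra R S] [Algebra R F] [IsFractionRing R F] [Algebra S L]
    [FaithfulSMul S L] [Algebra F L] [Algebra R L] [IsScalarTower R S L] [IsScalarTower R F L]
    {s : S} (hs : IsSeparable F (algebraMap S L s)) :
    ∃ P : R[X], aeval s P = 0 ∧ aeval s P.derivative ≠ 0 := by
  have hder := hs.aeval_derivative_ne_zero (minpoly.aeval F (algebraMap S L s))
  obtain ⟨b, hbR, hb⟩ := IsLocalization.integerNormalization_spec (nonZeroDivisors R)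
    (minpoly F (algebraMap S L s))
  have key (Q : R[X]) : algebraMap S L (aeval s Q) =
      aeval (algebraMap S L s) (Q.map (algebraMap R F)) := by
    rw [aeval_map_algebraMap, aeval_algebraMap_apply]
  have hinj := FaithfulSMul.algebraMap_injective S L
  refine ⟨IsLocalization.integerNormalization (nonZeroDivisors R)
    (minpoly F (algebraMap S L s)), hinj ?_, fun h0 => ?_⟩
  · rw [key, hb, map_zero, ← algebraMap_smul F b, map_smul, minpoly.aeval, smul_zero]
  · have := key (derivative (IsLocalization.integerNormalization (nonZeroDivisors R)
      (minpoly F (algebraMap S L s))))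
    rw [h0, map_zero, ← derivative_map, hb, ← algebraMap_smul F b,
      derivative_smul, map_smul, eq_comm, smul_eq_zero] at this
    refine this.elim (fun hb0 => ?_) hder
    exact nonZeroDivisors.ne_zero hbR (IsFractionRing.injective R F (by rw [hb0, map_zero]))

theorem IsAlgebraicSeparable.exists_simple_root {R S : Type*} [CommRing R] [IsDomain R] [CommRing S]
    [IsDomain S] [Algebra R S] [FaithfulSMul R S] {s : S} (hs : IsAlgebraicSeparable R s) :
    ∃ P : Polynomial R, Polynomial.aeval s P = 0 ∧ Polynomial.aeval s P.derivative ≠ 0 :=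
  let _ : Algebra (FractionRing R) (FractionRing S) := FractionRing.liftAlgebra R (FractionRing S)
  IsSeparable.exists_simple_root (F := FractionRing R) (L := FractionRing S) hs

end

/-! ### Both cases of the theorem -/

theorem corollary2p3 {A K : Type*} [CommRing A] [IsDomain A] [Field K] [Algebra A K]
    [IsFractionRing A K] (n : ℕ) (f : MvPowerSeries (Fin n) K)
    (hf : IsAlgebraic (MvPolynomial (Fin n) A) f ∨
      IsAlgebraicSeparable (MvPowerSeries (Fin n) A) f) :
    ∃ a : A, a ≠ 0 ∧ ∃ g : MvPowerSeries (Fin n) A,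
      MvPowerSeries.C (algebraMap A K a) *
          MvPowerSeries.rescale (fun _ => algebraMap A K a) f =
        MvPowerSeries.map (algebraMap A K) g := by
  obtain ⟨P, hP, hroot, hsimple⟩ : ∃ P : Polynomial (MvPowerSeries (Fin n) K),
      (∀ i, P.coeff i ∈ MvPowerSeries.boundedDenominators (Fin n) A K) ∧ P.eval f = 0 ∧
        P.derivative.eval f ≠ 0 := by
    rcases hf with ⟨P, hP, hf⟩ | hf
    · have hinj : Function.Injective (MvPolynomial.map (σ := Fin n) (algebraMap A K)) :=
        MvPolynomial.map_injective _ (IsFractionRing.injective A K)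
      obtain ⟨Q, hQ, hQ'⟩ := MvPowerSeries.exists_simple_root_polynomial (f := f)
        (P.map (MvPolynomial.map (algebraMap A K)))
        ((Polynomial.map_ne_zero_iff hinj).2 hP) (by
          rw [Polynomial.map_map, Polynomial.eval_map, ← hf, Polynomial.aeval_def]
          rfl)
      refine ⟨_, fun i => ?_, hQ, hQ'⟩
      rw [Polynomial.coeff_map]
      refine MvPowerSeries.mem_boundedDenominators_of_finite_support
        (Q.coeff i).support.finite_toSet fun α hα => ?_
      simpa using hα
    · obtain ⟨P, hP, hP'⟩ := hf.exists_simple_root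
      refine ⟨P.map (algebraMap _ _), fun i => ?_, ?_, ?_⟩
      · rw [Polynomial.coeff_map]
        exact MvPowerSeries.map_mem_boundedDenominators _
      · rwa [Polynomial.eval_map_algebraMap]
      · rwa [Polynomial.derivative_map, Polynomial.eval_map_algebraMap]
  obtain ⟨a, ha, hcoeff⟩ := MvPowerSeries.exists_pow_mul_coeff_mem_range hP hroot hsimple
  choose g hg using hcoeff
  refine ⟨a, ha, g, ?_⟩
  ext α
  have hg' : MvPowerSeries.coeff α (MvPowerSeries.map (algebraMap A K) g) = algebraMap A K (g α) :=
    rfl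
  rw [hg', hg, MvPowerSeries.coeff_C_mul, MvPowerSeries.coeff_rescale, Finsupp.prod,
    Finset.prod_pow_eq_pow_sum, ← Finsupp.degree_apply, pow_succ']
  ring
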